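/- **Setting.** Let $d \ge 1$, let $X_1, X_2, \dots$ be i.i.d. random vectors in $\mathbb{R}^d$ with distribution $F$, and let $F_n$ be the empirical distribution of $X_1,\dots,X_n$. For a distribution $G$ on $\mathbb{R}^d$ and a unit vector $u \in S^{d-1}$, let $G_u$ be the distribution of $u'Y$ for $Y \sim G$, and write $F_{nu}$ for $(F_n)_u$. Let $\mu$ (location) and $\sigma \ge 0$ (scale) be real-valued functionals of distributions on $\mathbb{R}$. Define the outlyingness, the projection depth and, for $\alpha > 0$, the depth region by $$O(x,G)=\sup_{\|u\|=1}\frac{|u'x-\mu(G_u)|}{\sigma(G_u)},\qquad PD(x,G)=\frac{1}{1+O(x,G)},\qquad PD^\alpha(G)=\{x: PD(x,G)\ge\alpha\},$$ where $0/0=0$, $c/0=\infty$ for $c>0$, and $1/(1+\infty)=0$. For a weight function $w$ on $[0,1]$, the projection depth trimmed mean is $$PTM^\alpha(G)=\frac{\int_{PD^\alpha(G)}w(PD(x,G))\,x\,dG(x)}{\int_{PD^\alpha(G)}w(PD(x,G))\,dG(x)}.$$ **Theorem 6.** Let $0<\alpha<\alpha^*=\sup_{x}PD(x,F)$, and suppose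 that the denominator of $PTM^\alpha(F)$ is nonzero and that the contour $\{x:PD(x,F)=\alpha\}$ has $F$-probability zero. Let $\mu(F_u)$ and $\sigma(F_u)$ be continuous in $u\in S^{d-1}$ with $\sigma(F_u)>0$ for all $u \in S^{d-1}$, let $w$ be continuously differentiable on $[0,1]$, and assume $$\text{(C2')}\quad \sup_{\|u\|=1}|\mu(F_{nu})-\mu(F_u)|\to0,\quad \sup_{\|u\|=1}|\sigma(F_{nu})-\sigma(F_u)|\to0\quad\text{almost surely.}$$ Then the integrals defining $PTM^\alpha(F)$ exist, and almost surely the denominator of $PTM^\alpha(F_n)$ is nonzero for all large $n$ and $PTM^\alpha(F_n)\to PTM^\alpha(F)$. -/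

import Mathlib

open MeasureTheory ProbabilityTheory Filter Topology
open scoped ENNReal NNReal

noncomputable section

namespace ProjDepth

/-- The law `F_u` of the projection `u'X` of a random vector `X` with law `F`. -/
def projLaw {d : ℕ} (F : Measure (EuclideanSpace ℝ (Fin d))) (u : EuclideanSpace ℝ (Fin d)) :
    Measure ℝ :=
  F.map (fun x => inner ℝ u x)

/-- The absolute generalized standard deviation `|g(x, u, F)| = |u'x - μ(F_u)| / σ(F_u)`, with
values in `[0, ∞]`. Division in `ℝ≥0∞` makes it `0` when `u'x - μ(F_u) = σ(F_u) = 0`, and `∞` when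
`σ(F_u) = 0` and `u'x ≠ μ(F_u)`. -/
def absGSD {d : ℕ} (μ : Measure ℝ → ℝ) (σ : Measure ℝ → ℝ≥0)
    (F : Measure (EuclideanSpace ℝ (Fin d))) (u x : EuclideanSpace ℝ (Fin d)) : ℝ≥0∞ :=
  ENNReal.ofReal |inner ℝ u x - μ (projLaw F u)| / (σ (projLaw F u) : ℝ≥0∞)

/-- The outlyingness `O(x, F) = sup_{‖u‖ = 1} |g(x, u, F)|`, with values in `[0, ∞]`. -/
def outlyingness {d : ℕ} (μ : Measure ℝ → ℝ) (σ : Measure ℝ → ℝ≥0)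
    (F : Measure (EuclideanSpace ℝ (Fin d))) (x : EuclideanSpace ℝ (Fin d)) : ℝ≥0∞ :=
  ⨆ u ∈ Metric.sphere (0 : EuclideanSpace ℝ (Fin d)) 1, absGSD μ σ F u x

/-- The projection depth `PD(x, F) = 1 / (1 + O(x, F)) ∈ [0, 1]`, which is `0` when
`O(x, F) = ∞`. -/
def depth {d : ℕ} (μ : Measure ℝ → ℝ) (σ : Measure ℝ → ℝ≥0)
    (F : Measure (EuclideanSpace ℝ (Fin d))) (x : EuclideanSpace ℝ (Fin d)) : ℝ :=
  (1 / (1 + outlyingness μ σ F x)).toReal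

/-- The maximal depth `α* = sup_x PD(x, F)` (a supremum of numbers in `[0, 1]`). -/
def maxDepth {d : ℕ} (μ : Measure ℝ → ℝ) (σ : Measure ℝ → ℝ≥0)
    (F : Measure (EuclideanSpace ℝ (Fin d))) : ℝ :=
  ⨆ x, depth μ σ F x

/-- The projection depth region `PD^α(F) = {x : PD(x, F) ≥ α}`. -/
def depthRegion {d : ℕ} (μ : Measure ℝ → ℝ) (σ : Measure ℝ → ℝ≥0) (α : ℝ)
    (F : Measure (EuclideanSpace ℝ (Fin d))) : Set (EuclideanSpace ℝ (Fin d)) :=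
  {x | α ≤ depth μ σ F x}

/-- The projection depth contour `{x : PD(x, F) = α}`. -/
def depthContour {d : ℕ} (μ : Measure ℝ → ℝ) (σ : Measure ℝ → ℝ≥0) (α : ℝ)
    (F : Measure (EuclideanSpace ℝ (Fin d))) : Set (EuclideanSpace ℝ (Fin d)) :=
  {x | depth μ σ F x = α}

/-- The denominator `∫_{PD^α(F)} w(PD(x, F)) dF(x)` of the trimmed mean. -/
def ptmDenom {d : ℕ} (μ : Measure ℝ → ℝ) (σ : Measure ℝ → ℝ≥0) (w : ℝ → ℝ) (α : ℝ)
    (F : Measure (EuclideanSpace ℝ (Fin d))) : ℝ :=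
  ∫ x in depthRegion μ σ α F, w (depth μ σ F x) ∂F

/-- The projection depth trimmed mean
`PTM^α(F) = ∫_{PD^α(F)} w(PD(x, F)) x dF(x) / ∫_{PD^α(F)} w(PD(x, F)) dF(x)`. -/
def ptm {d : ℕ} (μ : Measure ℝ → ℝ) (σ : Measure ℝ → ℝ≥0) (w : ℝ → ℝ) (α : ℝ)
    (F : Measure (EuclideanSpace ℝ (Fin d))) : EuclideanSpace ℝ (Fin d) :=
  (ptmDenom μ σ w α F)⁻¹ • ∫ x in depthRegion μ σ α F, w (depth μ σ F x) • x ∂F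

/-- The empirical distribution `F_n` of the first `n` terms of the sequence `x` (the probability
measure with mass `1/n` at each of them, for `n ≥ 1`). -/
def empirical {d : ℕ} (x : ℕ → EuclideanSpace ℝ (Fin d)) (n : ℕ) :
    Measure (EuclideanSpace ℝ (Fin d)) :=
  (n : ℝ≥0∞)⁻¹ • ∑ i ∈ Finset.range n, Measure.dirac (x i)

end ProjDepth

end

noncomputable section

/-! Numerator and denominator of the empirical trimmed mean are sample averages whose integrand
depends on the sample through the empirical depth. Were that depth replaced by the depth for `F`,
the strong law would give the limits. The replacement costs little because the empirical depth
converges uniformly on the whole space (`tendstoUniformly_depth`): where both depths trim alike,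
only the weights differ, by a uniformly small amount; where they disagree, the `F`-depth is close to
`α`, and the frequency of such points is asymptotically the `F`-mass of a thin band shrinking to the
null contour (`norm_trimmed_sub_le`, `tendsto_sampleMean_trimmed`). All relevant points have
`F`-depth at least `α / 2`, hence lie in a bounded set (`exists_norm_le_of_le_depth`), so no moments
of `F` are needed. -/

namespace ProjDepth


/-! ### Regularity of the depth and its stability in the law. -/

section Depth

variable {d : ℕ} {μ : Measure ℝ → ℝ} {σ : Measure ℝ → ℝ≥0}
  {F G : Measure (EuclideanSpace ℝ (Fin d))}

lemma sphere_nonempty (hd : 1 ≤ d) :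
    (Metric.sphere (0 : EuclideanSpace ℝ (Fin d)) 1).Nonempty := by
  have : Nonempty (Fin d) := ⟨⟨0, hd⟩⟩
  have : Nontrivial (EuclideanSpace ℝ (Fin d)) := inferInstance
  exact NormedSpace.sphere_nonempty.2 zero_le_one

lemma depth_mem_Icc (x : EuclideanSpace ℝ (Fin d)) : depth μ σ F x ∈ Set.Icc (0 : ℝ) 1 := by
  refine ⟨ENNReal.toReal_nonneg, ?_⟩
  rw [depth, ← ENNReal.toReal_one]
  refine ENNReal.toReal_mono ENNReal.one_ne_top ?_
  rw [one_div, ENNReal.inv_le_one]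
  exact le_self_add

lemma le_depth_iff_mul_le_one (t : ℝ) (x : EuclideanSpace ℝ (Fin d)) :
    t ≤ depth μ σ F x ↔ ENNReal.ofReal t * (1 + outlyingness μ σ F x) ≤ 1 := by
  have h0 : 1 + outlyingness μ σ F x ≠ 0 := by simp
  have hfin : 1 / (1 + outlyingness μ σ F x) ≠ ∞ := by simp
  rw [depth, ← ENNReal.ofReal_le_iff_le_toReal hfin]
  refine ENNReal.le_div_iff_mul_le (Or.inl h0) (Or.inr ENNReal.one_ne_top)

/-- The depth is at least `t` exactly when every direction has outlyingness at most
`(1 - t) / t`. -/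
lemma le_depth_iff (hd : 1 ≤ d)
    (hσ : ∀ u ∈ Metric.sphere (0 : EuclideanSpace ℝ (Fin d)) 1, 0 < σ (projLaw F u))
    {t : ℝ} (ht : 0 < t) (x : EuclideanSpace ℝ (Fin d)) :
    t ≤ depth μ σ F x ↔ ∀ u ∈ Metric.sphere (0 : EuclideanSpace ℝ (Fin d)) 1,
      t * (σ (projLaw F u) + |inner ℝ u x - μ (projLaw F u)|) ≤ σ (projLaw F u) := by
  have hdir : ∀ u ∈ Metric.sphere (0 : EuclideanSpace ℝ (Fin d)) 1,
      (ENNReal.ofReal t * (1 + absGSD μ σ F u x) ≤ 1 ↔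
        t * (σ (projLaw F u) + |inner ℝ u x - μ (projLaw F u)|) ≤ σ (projLaw F u)) := by
    intro u hu
    have hs : 0 < (σ (projLaw F u) : ℝ) := hσ u hu
    rw [absGSD, ← ENNReal.ofReal_coe_nnreal, ← ENNReal.ofReal_div_of_pos hs,
      ← ENNReal.ofReal_one, ← ENNReal.ofReal_add zero_le_one (by positivity),
      ← ENNReal.ofReal_mul ht.le, ENNReal.ofReal_le_ofReal_iff zero_le_one,
      ← mul_le_mul_iff_of_pos_right hs]
    field_simp
  rw [le_depth_iff_mul_le_one]
  constructor
  · intro h u hu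
    refine (hdir u hu).1 (le_trans ?_ h)
    gcongr
    exact le_iSup₂ (f := fun u (_ : u ∈ Metric.sphere (0 : EuclideanSpace ℝ (Fin d)) 1) =>
      absGSD μ σ F u x) u hu
  · intro h
    -- Moving `1 +` inside the supremum is false over an empty index set; this is where `1 ≤ d`
    -- enters.
    have : Nonempty (Metric.sphere (0 : EuclideanSpace ℝ (Fin d)) 1) :=
      (sphere_nonempty hd).to_subtype
    rw [outlyingness, iSup_subtype', ENNReal.add_iSup, ENNReal.mul_iSup]
    exact iSup_le fun u => (hdir u u.2).2 (h u u.2)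

lemma measurable_depth (hd : 1 ≤ d)
    (hσ : ∀ u ∈ Metric.sphere (0 : EuclideanSpace ℝ (Fin d)) 1, 0 < σ (projLaw F u)) :
    Measurable (depth μ σ F) := by
  refine measurable_of_Ici fun t => ?_
  rcases le_or_gt t 0 with ht | ht
  · convert MeasurableSet.univ
    exact Set.eq_univ_of_forall fun x => ht.trans (depth_mem_Icc x).1
  · have : depth μ σ F ⁻¹' Set.Ici t =
        ⋂ u ∈ Metric.sphere (0 : EuclideanSpace ℝ (Fin d)) 1,
          {x | t * (σ (projLaw F u) + |inner ℝ u x - μ (projLaw F u)|) ≤ σ (projLaw F u)} := by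
      ext x
      simp only [Set.mem_preimage, Set.mem_Ici, Set.mem_iInter, Set.mem_ofPred_eq]
      exact le_depth_iff hd hσ ht x
    rw [this]
    -- The intersection is uncountable, so measurability comes from closedness.
    refine (isClosed_biInter fun u _ => ?_).measurableSet
    exact isClosed_le (by fun_prop) continuous_const

/-- The depth is bounded away from zero only on a bounded set. -/
lemma exists_norm_le_of_le_depth (hd : 1 ≤ d)
    (hμ : ContinuousOn (fun u => μ (projLaw F u)) (Metric.sphere 0 1))
    (hσ : ContinuousOn (fun u => σ (projLaw F u)) (Metric.sphere 0 1))
    (hσ_pos : ∀ u ∈ Metric.sphere (0 : EuclideanSpace ℝ (Fin d)) 1, 0 < σ (projLaw F u))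
    {β : ℝ} (hβ : 0 < β) :
    ∃ R, ∀ x, β ≤ depth μ σ F x → ‖x‖ ≤ R := by
  have hcpt := isCompact_sphere (0 : EuclideanSpace ℝ (Fin d)) 1
  obtain ⟨A, hA⟩ := hcpt.exists_bound_of_continuousOn hμ
  obtain ⟨B, hB⟩ := hcpt.exists_bound_of_continuousOn
    (NNReal.continuous_coe.comp_continuousOn hσ)
  obtain ⟨v, hv⟩ := sphere_nonempty hd
  have hA0 : 0 ≤ A := (norm_nonneg _).trans (hA v hv)
  have hB0 : 0 ≤ B := (norm_nonneg _).trans (hB v hv)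
  refine ⟨A + B / β, fun x hx => ?_⟩
  rcases eq_or_ne x 0 with rfl | hx0
  · rw [norm_zero]; positivity
  have hnx : ‖x‖ ≠ 0 := norm_ne_zero_iff.2 hx0
  -- The direction of `x` itself: its projection there is `‖x‖`.
  have hu : ‖x‖⁻¹ • x ∈ Metric.sphere (0 : EuclideanSpace ℝ (Fin d)) 1 := by
    rw [mem_sphere_zero_iff_norm, norm_smul, norm_inv, norm_norm, inv_mul_cancel₀ hnx]
  have h := (le_depth_iff hd hσ_pos hβ x).1 hx _ hu
  have hin : inner ℝ (‖x‖⁻¹ • x) x = ‖x‖ := by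
    rw [real_inner_smul_left, real_inner_self_eq_norm_sq]
    field_simp
  rw [hin] at h
  have hA' := (abs_le.1 (hA _ hu)).2
  have hB' : (σ (projLaw F (‖x‖⁻¹ • x)) : ℝ) ≤ B := (le_abs_self _).trans (hB _ hu)
  have hs : (0 : ℝ) ≤ σ (projLaw F (‖x‖⁻¹ • x)) := NNReal.coe_nonneg _
  have h1 : β * (‖x‖ - A) ≤ B := by
    refine le_trans ?_ (h.trans hB')
    gcongr
    linarith [le_abs_self (‖x‖ - μ (projLaw F (‖x‖⁻¹ • x)))]
  have h2 : ‖x‖ - A ≤ B / β := by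
    rw [le_div_iff₀ hβ]
    linarith
  linarith

/-- The depths for two laws with close projected locations and scales are close. -/
lemma depth_le_depth_add (hd : 1 ≤ d) {c e : ℝ} (hc : 0 < c) (he : 0 ≤ e)
    (hF : ∀ u ∈ Metric.sphere (0 : EuclideanSpace ℝ (Fin d)) 1, c ≤ σ (projLaw F u))
    (hG : ∀ u ∈ Metric.sphere (0 : EuclideanSpace ℝ (Fin d)) 1, c ≤ σ (projLaw G u))
    (hFG : ∀ u ∈ Metric.sphere (0 : EuclideanSpace ℝ (Fin d)) 1,
      |μ (projLaw F u) - μ (projLaw G u)| ≤ e ∧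
      |(σ (projLaw F u) : ℝ) - σ (projLaw G u)| ≤ e) (x : EuclideanSpace ℝ (Fin d)) :
    depth μ σ F x ≤ depth μ σ G x + 2 * e / c := by
  -- `le_depth_iff` requires a positive level; if `depth μ σ F x - 2 * e / c` is not positive, the
  -- bound is trivial.
  rcases le_or_gt (depth μ σ F x) (2 * e / c) with h | h
  · linarith [(depth_mem_Icc (μ := μ) (σ := σ) (F := G) x).1]
  rw [← sub_le_iff_le_add, le_depth_iff hd (fun u hu => NNReal.coe_pos.1 (hc.trans_le (hG u hu)))
    (sub_pos.2 h)]
  intro u hu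
  have hδ : 0 ≤ 2 * e / c := by positivity
  have ht := (le_depth_iff hd (fun u hu => NNReal.coe_pos.1 (hc.trans_le (hF u hu)))
    (hδ.trans_lt h) x).1 le_rfl u hu
  obtain ⟨h1, h2⟩ := hFG u hu
  have hs := hF u hu
  have hs' := hG u hu
  have ha' : |inner ℝ u x - μ (projLaw G u)| ≤ |inner ℝ u x - μ (projLaw F u)| + e := by
    have := abs_sub_le (inner ℝ u x) (μ (projLaw F u)) (μ (projLaw G u))
    linarith
  have ha0 := abs_nonneg (inner ℝ u x - μ (projLaw F u))
  have ha0' := abs_nonneg (inner ℝ u x - μ (projLaw G u))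
  generalize |inner ℝ u x - μ (projLaw F u)| = a at *
  generalize |inner ℝ u x - μ (projLaw G u)| = a' at *
  generalize (σ (projLaw F u) : ℝ) = s at *
  generalize (σ (projLaw G u) : ℝ) = s' at *
  have hδc : 2 * e / c * c = 2 * e := div_mul_cancel₀ _ hc.ne'
  generalize depth μ σ F x = t at *
  generalize 2 * e / c = δ at *
  have hsa : 0 < s + a := by linarith
  -- The directional depths are `s / (s + a)` and `s' / (s' + a')`. The left side is the numerator
  -- of their difference and equals `s * (a' - a) + a * (s - s')`.
  have hk : s * (s' + a') - s' * (s + a) ≤ (s + a) * (2 * e) := by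
    have := mul_le_mul_of_nonneg_left (sub_le_iff_le_add'.2 ha') (hc.le.trans hs)
    have := mul_le_mul_of_nonneg_left (abs_le.1 h2).2 ha0
    nlinarith
  have hk2 : (s + a) * (2 * e) ≤ (s + a) * (δ * (s' + a')) := by
    rw [← hδc]
    gcongr
    linarith
  have hk3 : t * (s + a) * (s' + a') ≤ s * (s' + a') :=
    mul_le_mul_of_nonneg_right ht (by linarith)
  refine le_of_mul_le_mul_left ?_ hsa
  nlinarith

/-- Uniform convergence of the projected locations and scales implies uniform convergence of the
depth on the whole space. -/
lemma tendstoUniformly_depth (hd : 1 ≤ d) {H : ℕ → Measure (EuclideanSpace ℝ (Fin d))}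
    (hσ : ContinuousOn (fun u => σ (projLaw F u)) (Metric.sphere 0 1))
    (hσ_pos : ∀ u ∈ Metric.sphere (0 : EuclideanSpace ℝ (Fin d)) 1, 0 < σ (projLaw F u))
    (hμH : TendstoUniformlyOn (fun n u => μ (projLaw (H n) u)) (fun u => μ (projLaw F u)) atTop
      (Metric.sphere 0 1))
    (hσH : TendstoUniformlyOn (fun n u => σ (projLaw (H n) u)) (fun u => σ (projLaw F u)) atTop
      (Metric.sphere 0 1)) :
    TendstoUniformly (fun n => depth μ σ (H n)) (depth μ σ F) atTop := by
  obtain ⟨v, hv, hmin⟩ := (isCompact_sphere (0 : EuclideanSpace ℝ (Fin d)) 1).exists_isMinOn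
    (sphere_nonempty hd) hσ
  -- Half the minimal scale: an error of at most `c` still leaves the scales of `H n` above `c`.
  obtain ⟨c, hc, hcv⟩ : ∃ c : ℝ, 0 < c ∧ (σ (projLaw F v) : ℝ) = 2 * c :=
    ⟨σ (projLaw F v) / 2, half_pos (hσ_pos v hv), by ring⟩
  have hF : ∀ u ∈ Metric.sphere (0 : EuclideanSpace ℝ (Fin d)) 1,
      2 * c ≤ σ (projLaw F u) := fun u hu => hcv ▸ hmin hu
  rw [Metric.tendstoUniformly_iff]
  intro ε hε
  have he : 0 < min c (ε * c / 4) := by positivity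
  filter_upwards [Metric.tendstoUniformlyOn_iff.1 hμH _ he,
    Metric.tendstoUniformlyOn_iff.1 hσH _ he] with n hn1 hn2 x
  have hn1' : ∀ u ∈ Metric.sphere (0 : EuclideanSpace ℝ (Fin d)) 1,
      |μ (projLaw F u) - μ (projLaw (H n) u)| ≤ min c (ε * c / 4) :=
    fun u hu => (hn1 u hu).le
  have hn2' : ∀ u ∈ Metric.sphere (0 : EuclideanSpace ℝ (Fin d)) 1,
      |(σ (projLaw F u) : ℝ) - σ (projLaw (H n) u)| ≤ min c (ε * c / 4) :=
    fun u hu => (hn2 u hu).le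
  have hFc : ∀ u ∈ Metric.sphere (0 : EuclideanSpace ℝ (Fin d)) 1, c ≤ σ (projLaw F u) :=
    fun u hu => by linarith [hF u hu]
  have hHc : ∀ u ∈ Metric.sphere (0 : EuclideanSpace ℝ (Fin d)) 1, c ≤ σ (projLaw (H n) u) :=
    fun u hu => by
      linarith [hF u hu, (abs_le.1 (hn2' u hu)).2, min_le_left c (ε * c / 4)]
  have h1 := depth_le_depth_add (μ := μ) hd hc he.le hFc hHc
    (fun u hu => ⟨hn1' u hu, hn2' u hu⟩) x
  have h2 := depth_le_depth_add (μ := μ) hd hc he.le hHc hFc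
    (fun u hu => ⟨abs_sub_comm (μ (projLaw F u)) _ ▸ hn1' u hu,
      abs_sub_comm (σ (projLaw F u) : ℝ) _ ▸ hn2' u hu⟩) x
  have h3 : 2 * min c (ε * c / 4) / c < ε := by
    rw [div_lt_iff₀ hc]
    nlinarith [min_le_right c (ε * c / 4), mul_pos hε hc]
  rw [Real.dist_eq, abs_lt]
  constructor <;> linarith

end Depth


/-! ### Deterministic comparison of trimmed sample averages. -/

section Average

variable {E V : Type*} [NormedAddCommGroup V] [NormedSpace ℝ V]

/-- The average of `φ` over the first `n` terms of the sequence `x`. -/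
def sampleMean (x : ℕ → E) (φ : E → V) (n : ℕ) : V :=
  (n : ℝ)⁻¹ • ∑ i ∈ Finset.range n, φ (x i)

/-- The integrand of a trimmed mean with depth function `h`. -/
def trimmed (w : ℝ → ℝ) (α : ℝ) (g : E → V) (h : E → ℝ) : E → V :=
  {x | α ≤ h x}.indicator fun x => w (h x) • g x

/-- Points are measurable, so `s` and `φ` may be arbitrary; no measurability of the empirical depth
is then needed. -/
lemma setIntegral_empirical {d : ℕ} [CompleteSpace V] (x : ℕ → EuclideanSpace ℝ (Fin d)) (n : ℕ)
    (s : Set (EuclideanSpace ℝ (Fin d))) (φ : EuclideanSpace ℝ (Fin d) → V) :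
    ∫ y in s, φ y ∂(empirical x n) = sampleMean x (s.indicator φ) n := by
  classical
  rw [empirical, Measure.restrict_smul, integral_smul_measure, sampleMean, ENNReal.toReal_inv,
    ENNReal.toReal_natCast, ← Measure.restrictₗ_apply, map_sum, integral_finsetSum_measure]
  · congr 1
    refine Finset.sum_congr rfl fun i _ => ?_
    rw [Measure.restrictₗ_apply, setIntegral_dirac, Set.indicator_apply]
  · intro i _
    rw [Measure.restrictₗ_apply]
    exact (integrable_dirac enorm_lt_top).integrableOn

lemma norm_sampleMean_sub_le {x : ℕ → E} {φ ψ : E → V} {χ : E → ℝ} {ε K : ℝ} (hε : 0 ≤ ε)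
    (h : ∀ y, ‖φ y - ψ y‖ ≤ ε + K * χ y) (n : ℕ) :
    ‖sampleMean x φ n - sampleMean x ψ n‖ ≤ ε + K * sampleMean x χ n := by
  rw [sampleMean, sampleMean, sampleMean, ← smul_sub, ← Finset.sum_sub_distrib, norm_smul,
    norm_inv, Real.norm_natCast, smul_eq_mul]
  calc (n : ℝ)⁻¹ * ‖∑ i ∈ Finset.range n, (φ (x i) - ψ (x i))‖
      ≤ (n : ℝ)⁻¹ * ∑ i ∈ Finset.range n, (ε + K * χ (x i)) := by
        gcongr
        exact norm_sum_le_of_le _ fun i _ => h (x i)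
    _ = (n : ℝ)⁻¹ * n * ε + K * ((n : ℝ)⁻¹ * ∑ i ∈ Finset.range n, χ (x i)) := by
        rw [Finset.sum_add_distrib, Finset.sum_const, Finset.card_range, nsmul_eq_mul,
          ← Finset.mul_sum]
        ring
    _ ≤ ε + K * ((n : ℝ)⁻¹ * ∑ i ∈ Finset.range n, χ (x i)) := by
        gcongr
        -- Only an inequality, since `n⁻¹ * n = 0` at `n = 0`.
        exact mul_le_of_le_one_left hε inv_mul_le_one

lemma trimmed_of_le {w : ℝ → ℝ} {α : ℝ} {g : E → V} {h : E → ℝ} {x : E} (hx : α ≤ h x) :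
    trimmed w α g h x = w (h x) • g x :=
  Set.indicator_of_mem (s := {x | α ≤ h x}) hx _

lemma trimmed_of_not_le {w : ℝ → ℝ} {α : ℝ} {g : E → V} {h : E → ℝ} {x : E} (hx : ¬α ≤ h x) :
    trimmed w α g h x = 0 :=
  Set.indicator_of_notMem (s := {x | α ≤ h x}) hx _

/-- The indicator of the points at which `h` is within `δ` of `α`. -/
def nearContour (h : E → ℝ) (α δ : ℝ) : E → ℝ :=
  {x | |h x - α| ≤ δ}.indicator fun _ => 1

lemma nearContour_of_le {h : E → ℝ} {α δ : ℝ} {x : E} (hx : |h x - α| ≤ δ) :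
    nearContour h α δ x = 1 :=
  Set.indicator_of_mem (s := {x | |h x - α| ≤ δ}) hx _

lemma nearContour_nonneg (h : E → ℝ) (α δ : ℝ) (x : E) : 0 ≤ nearContour h α δ x :=
  Set.indicator_nonneg (fun _ _ => zero_le_one) x

/-- The first term pays for differing weights, the second for points trimmed by only one of `h` and
`k`, which force `|h x - α| ≤ δ`. Since `β + δ ≤ α`, a point kept by either function has `β ≤ h x`,
so `g` is bounded there. -/
lemma norm_trimmed_sub_le {w : ℝ → ℝ} {α β C M ε δ : ℝ} {g : E → V} {h k : E → ℝ}
    (hβ : β + δ ≤ α) (hM : 0 ≤ M) (hε : 0 ≤ ε) (hC : 0 ≤ C)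
    (hg : ∀ x, β ≤ h x → ‖g x‖ ≤ C) (hwh : ∀ x, |w (h x)| ≤ M) (hwk : ∀ x, |w (k x)| ≤ M)
    (hhk : ∀ x, |h x - k x| ≤ δ) (hwhk : ∀ x, |w (h x) - w (k x)| ≤ ε) (x : E) :
    ‖trimmed w α g k x - trimmed w α g h x‖ ≤ ε * C + M * C * nearContour h α δ x := by
  have hεC : 0 ≤ ε * C := by positivity
  have hδ := abs_le.1 (hhk x)
  have hi : 0 ≤ M * C * nearContour h α δ x := by
    have := nearContour_nonneg h α δ x
    positivity
  by_cases h1 : α ≤ h x <;> by_cases h2 : α ≤ k x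
  · have hgx := hg x (by linarith)
    rw [trimmed_of_le h2, trimmed_of_le h1, ← sub_smul, norm_smul, Real.norm_eq_abs, abs_sub_comm]
    have := mul_le_mul (hwhk x) hgx (norm_nonneg _) hε
    linarith
  · have hgx := hg x (by linarith)
    have hmem : |h x - α| ≤ δ := abs_le.2 ⟨by linarith, by linarith⟩
    rw [trimmed_of_not_le h2, trimmed_of_le h1, nearContour_of_le hmem, zero_sub, norm_neg,
      norm_smul, Real.norm_eq_abs]
    have := mul_le_mul (hwh x) hgx (norm_nonneg _) hM
    linarith
  · have hgx := hg x (by linarith)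
    have hmem : |h x - α| ≤ δ := abs_le.2 ⟨by linarith, by linarith⟩
    rw [trimmed_of_le h2, trimmed_of_not_le h1, nearContour_of_le hmem, sub_zero, norm_smul,
      Real.norm_eq_abs]
    have := mul_le_mul (hwk x) hgx (norm_nonneg _) hM
    linarith
  · rw [trimmed_of_not_le h2, trimmed_of_not_le h1, sub_zero, norm_zero]
    linarith

/-- Replacing the depth by uniformly convergent approximations does not change the limit of
trimmed sample averages, when the contour is asymptotically negligible. -/
lemma tendsto_sampleMean_trimmed {x : ℕ → E} {h : E → ℝ} {hn : ℕ → E → ℝ}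
    {w : ℝ → ℝ} {α β : ℝ} {g : E → V} {C : ℝ} {L : V} {p : ℕ → ℝ} (hβα : β < α)
    (hw : ContinuousOn w (Set.Icc 0 1)) (hh : ∀ x, h x ∈ Set.Icc (0 : ℝ) 1)
    (hhn : ∀ n x, hn n x ∈ Set.Icc (0 : ℝ) 1) (hunif : TendstoUniformly hn h atTop)
    (hC : 0 ≤ C) (hg : ∀ x, β ≤ h x → ‖g x‖ ≤ C)
    (hL : Tendsto (sampleMean x (trimmed w α g h)) atTop (𝓝 L))
    (hp : ∀ k : ℕ, Tendsto (sampleMean x (nearContour h α (1 / ((k : ℝ) + 1)))) atTop (𝓝 (p k)))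
    (hp0 : Tendsto p atTop (𝓝 0)) :
    Tendsto (fun n => sampleMean x (trimmed w α g (hn n)) n) atTop (𝓝 L) := by
  obtain ⟨M, hM⟩ := isCompact_Icc.exists_bound_of_continuousOn hw
  have hM0 : 0 ≤ M := (norm_nonneg _).trans (hM 0 (by simp))
  have huc := isCompact_Icc.uniformContinuousOn_of_continuous hw
  rw [Metric.uniformContinuousOn_iff] at huc
  suffices H : Tendsto (fun n => sampleMean x (trimmed w α g (hn n)) n -
      sampleMean x (trimmed w α g h) n) atTop (𝓝 0) by
    simpa using H.add hL
  refine Metric.tendsto_nhds.2 fun ε hε => ?_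
  simp_rw [dist_zero_right]
  obtain ⟨η, hη, hηε⟩ : ∃ η, 0 < η ∧ η * C < ε / 2 := by
    refine ⟨ε / (2 * (C + 1)), by positivity, ?_⟩
    rw [div_mul_eq_mul_div, div_lt_div_iff₀ (by positivity) two_pos]
    nlinarith
  obtain ⟨δ, hδ, hδw⟩ := huc η hη
  have hpk : Tendsto (fun k => M * C * p k) atTop (𝓝 0) := by
    simpa using hp0.const_mul (M * C)
  -- The band width is fixed before `n` grows: it makes the limiting contour error less than `ε / 2`
  -- and keeps the band above level `β`.
  obtain ⟨k, hk1, hk2⟩ := ((hpk.eventually_lt_const (half_pos hε)).and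
    (tendsto_one_div_add_atTop_nhds_zero_nat.eventually_lt_const (sub_pos.2 hβα))).exists
  have hkpos : (0 : ℝ) < 1 / ((k : ℝ) + 1) := by positivity
  filter_upwards [((hp k).const_mul (M * C)).eventually_lt_const hk1,
    Metric.tendstoUniformly_iff.1 hunif _ (lt_min hδ hkpos)] with n hn1 hn2
  have hb := norm_sampleMean_sub_le (x := x) (mul_nonneg hη.le hC)
    (norm_trimmed_sub_le (w := w) (α := α) (h := h) (k := hn n) (by linarith) hM0 hη.le hC hg
      (fun y => hM _ (hh y)) (fun y => hM _ (hhn n y))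
      (fun y => ((hn2 y).trans_le (min_le_right _ _)).le)
      (fun y => (hδw _ (hh y) _ (hhn n y) ((hn2 y).trans_le (min_le_left _ _))).le)) n
  linarith

end Average


/-! ### Strong law and almost sure convergence of the trimmed integrals. -/

section Convergence

/-- The strong law of large numbers for measurable functions of a random sample. -/
lemma ae_tendsto_sampleMean {E V Ω : Type*} [MeasurableSpace E] [NormedAddCommGroup V]
    [NormedSpace ℝ V] [CompleteSpace V] [MeasurableSpace V] [BorelSpace V]
    [SecondCountableTopology V] [MeasurableSpace Ω] {P : Measure Ω} {F : Measure E}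
    {X : ℕ → Ω → E} (hX : ∀ i, Measurable (X i)) (hlaw : ∀ i, P.map (X i) = F)
    (hindep : iIndepFun X P) {φ : E → V} (hφ : Measurable φ) (hint : Integrable φ F) :
    ∀ᵐ ω ∂P, Tendsto (sampleMean (fun i => X i ω) φ) atTop (𝓝 (∫ x, φ x ∂F)) := by
  have hlaw0 := hlaw 0
  have h := strong_law_ae (μ := P) (fun i ω => φ (X i ω))
    (by rw [← hlaw0] at hint; exact hint.comp_measurable (hX 0))
    (fun i j hij => (hindep.indepFun hij).comp hφ hφ)
    (fun i => IdentDistrib.comp ⟨(hX i).aemeasurable, (hX 0).aemeasurable,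
      (hlaw i).trans hlaw0.symm⟩ hφ)
  have hI : ∫ x, φ x ∂F = ∫ ω, φ (X 0 ω) ∂P := by
    rw [← hlaw0, integral_map (hX 0).aemeasurable hφ.aestronglyMeasurable]
  rw [hI]
  exact h

variable {d : ℕ} {V Ω : Type*} [NormedAddCommGroup V] [NormedSpace ℝ V]
  [MeasurableSpace V] [BorelSpace V] [SecondCountableTopology V]
  {μ : Measure ℝ → ℝ} {σ : Measure ℝ → ℝ≥0}
  {F : Measure (EuclideanSpace ℝ (Fin d))}

lemma measurableSet_depthRegion (hd : 1 ≤ d)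
    (hσ_pos : ∀ u ∈ Metric.sphere (0 : EuclideanSpace ℝ (Fin d)) 1, 0 < σ (projLaw F u)) (α : ℝ) :
    MeasurableSet (depthRegion μ σ α F) :=
  measurableSet_le measurable_const (measurable_depth hd hσ_pos)

lemma measurable_weight_depth (hd : 1 ≤ d)
    (hσ_pos : ∀ u ∈ Metric.sphere (0 : EuclideanSpace ℝ (Fin d)) 1, 0 < σ (projLaw F u))
    {w : ℝ → ℝ} (hw : ContinuousOn w (Set.Icc 0 1)) :
    Measurable fun x => w (depth μ σ F x) := by
  -- `w` is controlled only on `[0, 1]`, so the composition is factored through that subtype.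
  have h : Measurable fun x => (⟨depth μ σ F x, depth_mem_Icc x⟩ : Set.Icc (0 : ℝ) 1) :=
    (measurable_depth hd hσ_pos).subtype_mk
  exact (continuousOn_iff_continuous_domRestrict.1 hw).measurable.comp h

lemma measurable_trimmed_depth (hd : 1 ≤ d)
    (hσ_pos : ∀ u ∈ Metric.sphere (0 : EuclideanSpace ℝ (Fin d)) 1, 0 < σ (projLaw F u))
    {w : ℝ → ℝ} (hw : ContinuousOn w (Set.Icc 0 1)) (α : ℝ)
    {g : EuclideanSpace ℝ (Fin d) → V} (hg : Continuous g) :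
    Measurable (trimmed w α g (depth μ σ F)) :=
  ((measurable_weight_depth hd hσ_pos hw).smul hg.measurable).indicator
    (measurableSet_depthRegion hd hσ_pos α)

lemma exists_bound_of_le_depth {W : Type*} [NormedAddCommGroup W] (hd : 1 ≤ d)
    (hμ : ContinuousOn (fun u => μ (projLaw F u)) (Metric.sphere 0 1))
    (hσ : ContinuousOn (fun u => σ (projLaw F u)) (Metric.sphere 0 1))
    (hσ_pos : ∀ u ∈ Metric.sphere (0 : EuclideanSpace ℝ (Fin d)) 1, 0 < σ (projLaw F u))
    {β : ℝ} (hβ : 0 < β) {g : EuclideanSpace ℝ (Fin d) → W} (hg : Continuous g) :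
    ∃ C, 0 ≤ C ∧ ∀ x, β ≤ depth μ σ F x → ‖g x‖ ≤ C := by
  obtain ⟨R, hR⟩ := exists_norm_le_of_le_depth hd hμ hσ hσ_pos hβ
  obtain ⟨C, hC⟩ := (isCompact_closedBall (0 : EuclideanSpace ℝ (Fin d))
    R).exists_bound_of_continuousOn hg.continuousOn
  exact ⟨max C 0, le_max_right _ _, fun x hx =>
    (hC x (mem_closedBall_zero_iff.2 (hR x hx))).trans (le_max_left _ _)⟩

lemma integrableOn_weight_depth_smul [IsFiniteMeasure F] (hd : 1 ≤ d)
    (hμ : ContinuousOn (fun u => μ (projLaw F u)) (Metric.sphere 0 1))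
    (hσ : ContinuousOn (fun u => σ (projLaw F u)) (Metric.sphere 0 1))
    (hσ_pos : ∀ u ∈ Metric.sphere (0 : EuclideanSpace ℝ (Fin d)) 1, 0 < σ (projLaw F u))
    {w : ℝ → ℝ} (hw : ContinuousOn w (Set.Icc 0 1)) {α : ℝ} (hα : 0 < α)
    {g : EuclideanSpace ℝ (Fin d) → V} (hg : Continuous g) :
    IntegrableOn (fun x => w (depth μ σ F x) • g x) (depthRegion μ σ α F) F := by
  obtain ⟨M, hM⟩ := isCompact_Icc.exists_bound_of_continuousOn hw
  obtain ⟨C, hC0, hC⟩ := exists_bound_of_le_depth hd hμ hσ hσ_pos hα hg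
  refine Measure.integrableOn_of_bounded (M := M * C) (measure_ne_top _ _)
    ((measurable_weight_depth hd hσ_pos hw).smul hg.measurable).aestronglyMeasurable ?_
  refine (ae_restrict_iff' (measurableSet_depthRegion hd hσ_pos α)).2 (.of_forall fun x hx => ?_)
  rw [norm_smul]
  have h1 := hM _ (depth_mem_Icc (μ := μ) (σ := σ) (F := F) x)
  exact mul_le_mul h1 (hC x hx) (norm_nonneg _) ((norm_nonneg _).trans h1)

/-- The bands decrease to the contour, so this is continuity from above of a finite measure. -/
lemma tendsto_integral_nearContour [IsFiniteMeasure F] (hd : 1 ≤ d)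
    (hσ_pos : ∀ u ∈ Metric.sphere (0 : EuclideanSpace ℝ (Fin d)) 1, 0 < σ (projLaw F u))
    {α : ℝ} (hcontour : F (depthContour μ σ α F) = 0) :
    Tendsto (fun k : ℕ => ∫ x, nearContour (depth μ σ F) α (1 / ((k : ℝ) + 1)) x ∂F) atTop
      (𝓝 0) := by
  have hm : ∀ k : ℕ, MeasurableSet {x | |depth μ σ F x - α| ≤ 1 / ((k : ℝ) + 1)} := fun k =>
    measurableSet_le ((measurable_depth hd hσ_pos).sub_const α).abs measurable_const
  have hI : ⋂ k : ℕ, {x | |depth μ σ F x - α| ≤ 1 / ((k : ℝ) + 1)} = depthContour μ σ α F := by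
    ext x
    simp only [Set.mem_iInter, depthContour, Set.mem_ofPred_eq]
    constructor
    · intro h
      have := ge_of_tendsto' tendsto_one_div_add_atTop_nhds_zero_nat h
      exact sub_eq_zero.1 (abs_nonpos_iff.1 this)
    · intro h k
      rw [h, sub_self, abs_zero]
      positivity
  have ht := tendsto_measure_iInter_atTop (μ := F) (fun k => (hm k).nullMeasurableSet)
    (fun i j hij x hx => le_trans (α := ℝ) hx (Nat.one_div_le_one_div hij))
    ⟨0, measure_ne_top _ _⟩
  rw [hI, hcontour] at ht
  have h2 := (ENNReal.tendsto_toReal ENNReal.zero_ne_top).comp ht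
  refine h2.congr fun k => ?_
  simp only [nearContour, Function.comp_apply]
  exact (integral_indicator_one (hm k)).symm

/-- With `g` constantly `1` this gives the denominator, with `g` the identity the numerator. -/
lemma ae_tendsto_setIntegral_empirical [CompleteSpace V] [MeasurableSpace Ω] {P : Measure Ω}
    [IsFiniteMeasure F] (hd : 1 ≤ d)
    {X : ℕ → Ω → EuclideanSpace ℝ (Fin d)} (hX : ∀ i, Measurable (X i))
    (hlaw : ∀ i, P.map (X i) = F) (hindep : iIndepFun X P)
    {w : ℝ → ℝ} {α : ℝ} (hα : 0 < α) (hcontour : F (depthContour μ σ α F) = 0)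
    (hμ : ContinuousOn (fun u => μ (projLaw F u)) (Metric.sphere 0 1))
    (hσ : ContinuousOn (fun u => σ (projLaw F u)) (Metric.sphere 0 1))
    (hσ_pos : ∀ u ∈ Metric.sphere (0 : EuclideanSpace ℝ (Fin d)) 1, 0 < σ (projLaw F u))
    (hw : ContinuousOn w (Set.Icc 0 1))
    (hunif : ∀ᵐ ω ∂P, TendstoUniformly
      (fun n => depth μ σ (empirical (fun i => X i ω) n)) (depth μ σ F) atTop)
    {g : EuclideanSpace ℝ (Fin d) → V} (hg : Continuous g) :
    ∀ᵐ ω ∂P, Tendsto (fun n => ∫ x in depthRegion μ σ α (empirical (fun i => X i ω) n),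
        w (depth μ σ (empirical (fun i => X i ω) n) x) • g x ∂(empirical (fun i => X i ω) n)) atTop
      (𝓝 (∫ x in depthRegion μ σ α F, w (depth μ σ F x) • g x ∂F)) := by
  obtain ⟨C, hC0, hC⟩ := exists_bound_of_le_depth hd hμ hσ hσ_pos (half_pos hα) hg
  have hreg := measurableSet_depthRegion (μ := μ) hd hσ_pos α
  have hnum := ae_tendsto_sampleMean hX hlaw hindep
    (measurable_trimmed_depth (μ := μ) hd hσ_pos hw α hg)
    ((integrable_indicator_iff hreg).2
      (integrableOn_weight_depth_smul hd hμ hσ hσ_pos hw hα hg))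
  -- Widths `1 / (k + 1)` form a countable family, so one null set serves all bands.
  have hnear : ∀ᵐ ω ∂P, ∀ k : ℕ, Tendsto (sampleMean (fun i => X i ω)
      (nearContour (depth μ σ F) α (1 / ((k : ℝ) + 1)))) atTop
      (𝓝 (∫ x, nearContour (depth μ σ F) α (1 / ((k : ℝ) + 1)) x ∂F)) := by
    refine ae_all_iff.2 fun k => ?_
    have hm : MeasurableSet {x | |depth μ σ F x - α| ≤ 1 / ((k : ℝ) + 1)} :=
      measurableSet_le ((measurable_depth hd hσ_pos).sub_const α).abs measurable_const
    exact ae_tendsto_sampleMean hX hlaw hindep (measurable_const.indicator hm)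
      ((integrable_const 1).indicator hm)
  filter_upwards [hnum, hnear, hunif] with ω h1 h2 h3
  have hlim : ∫ x, trimmed w α g (depth μ σ F) x ∂F =
      ∫ x in depthRegion μ σ α F, w (depth μ σ F x) • g x ∂F := integral_indicator hreg
  rw [hlim] at h1
  simp_rw [setIntegral_empirical]
  exact tendsto_sampleMean_trimmed (half_lt_self hα) hw depth_mem_Icc (fun _ => depth_mem_Icc) h3
    hC0 hC h1 h2 (tendsto_integral_nearContour hd hσ_pos hcontour)

end Convergence

end ProjDepth

end

theorem theorem6 {d : ℕ} (hd : 1 ≤ d)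
    -- a random sample from the distribution `F` on `ℝ^d`
    {Ω : Type*} [MeasurableSpace Ω] (P : Measure Ω) [IsProbabilityMeasure P]
    (F : Measure (EuclideanSpace ℝ (Fin d))) [IsProbabilityMeasure F]
    (X : ℕ → Ω → EuclideanSpace ℝ (Fin d)) (hX : ∀ i, Measurable (X i))
    (hlaw : ∀ i, P.map (X i) = F) (hindep : iIndepFun X P)
    -- the location and scale functionals, the weight function and the trimming level
    (μ : Measure ℝ → ℝ) (σ : Measure ℝ → ℝ≥0) (w : ℝ → ℝ) (α : ℝ)
    (hα : 0 < α) (hα_max : α < ProjDepth.maxDepth μ σ F)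
    -- the trimmed mean of `F` has a nonzero denominator
    (hdenom : ProjDepth.ptmDenom μ σ w α F ≠ 0)
    -- the contour of level `α` is `F`-null
    (hcontour : F (ProjDepth.depthContour μ σ α F) = 0)
    -- `μ(F_u)` and `σ(F_u)` are continuous in `u`, and `σ(F_u) > 0`
    (hμ : ContinuousOn (fun u => μ (ProjDepth.projLaw F u)) (Metric.sphere 0 1))
    (hσ : ContinuousOn (fun u => σ (ProjDepth.projLaw F u)) (Metric.sphere 0 1))
    (hσ_pos : ∀ u ∈ Metric.sphere (0 : EuclideanSpace ℝ (Fin d)) 1,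
      0 < σ (ProjDepth.projLaw F u))
    -- `w` is continuously differentiable on `[0, 1]`
    (hw : ContDiffOn ℝ 1 w (Set.Icc 0 1))
    -- almost surely, `μ(F_{nu}) → μ(F_u)` and `σ(F_{nu}) → σ(F_u)` uniformly in `u`
    (hC2 : ∀ᵐ ω ∂P,
      TendstoUniformlyOn
        (fun n u => μ (ProjDepth.projLaw (ProjDepth.empirical (fun i => X i ω) n) u))
        (fun u => μ (ProjDepth.projLaw F u)) atTop (Metric.sphere 0 1) ∧
      TendstoUniformlyOn
        (fun n u => σ (ProjDepth.projLaw (ProjDepth.empirical (fun i => X i ω) n) u))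
        (fun u => σ (ProjDepth.projLaw F u)) atTop (Metric.sphere 0 1)) :
    -- the integrals in `PTM^α(F)` exist, and almost surely `PTM^α(F_n)` is well defined for all
    -- large `n` and converges to `PTM^α(F)`
    IntegrableOn (fun x => w (ProjDepth.depth μ σ F x) • x) (ProjDepth.depthRegion μ σ α F) F ∧
    IntegrableOn (fun x => w (ProjDepth.depth μ σ F x)) (ProjDepth.depthRegion μ σ α F) F ∧
    ∀ᵐ ω ∂P,
      (∀ᶠ n in atTop,
        ProjDepth.ptmDenom μ σ w α (ProjDepth.empirical (fun i => X i ω) n) ≠ 0) ∧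
      Tendsto (fun n => ProjDepth.ptm μ σ w α (ProjDepth.empirical (fun i => X i ω) n)) atTop
        (𝓝 (ProjDepth.ptm μ σ w α F)) := by
  have hwc := hw.continuousOn
  have hunif : ∀ᵐ ω ∂P, TendstoUniformly
      (fun n => ProjDepth.depth μ σ (ProjDepth.empirical (fun i => X i ω) n))
      (ProjDepth.depth μ σ F) atTop := by
    filter_upwards [hC2] with ω hω
    exact ProjDepth.tendstoUniformly_depth hd hσ hσ_pos hω.1 hω.2
  refine ⟨ProjDepth.integrableOn_weight_depth_smul hd hμ hσ hσ_pos hwc hα continuous_id, ?_, ?_⟩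
  · simpa only [smul_eq_mul, mul_one] using
      ProjDepth.integrableOn_weight_depth_smul hd hμ hσ hσ_pos hwc hα
        (continuous_const (y := (1 : ℝ)))
  filter_upwards [ProjDepth.ae_tendsto_setIntegral_empirical hd hX hlaw hindep hα hcontour hμ hσ
      hσ_pos hwc hunif (continuous_const (y := (1 : ℝ))),
    ProjDepth.ae_tendsto_setIntegral_empirical hd hX hlaw hindep hα hcontour hμ hσ
      hσ_pos hwc hunif continuous_id] with ω h1 h2
  simp only [smul_eq_mul, mul_one] at h1
  exact ⟨h1.eventually_ne hdenom, (h1.inv₀ hdenom).smul h2⟩
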